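/- Let $G$ be a discrete group. A compact $G$-space is a nonempty compact Hausdorff space on which $G$ acts by homeomorphisms. A $G$-boundary is a compact $G$-space $X$ on which the action is minimal (every orbit is dense) and strongly proximal (for every regular Borel probability measure $\nu$ on $X$, the weak* closure of the orbit $G\nu$ contains a point mass). The Furstenberg boundary $\partial_F G$ is the universal $G$-boundary, i.e. the $G$-boundary, unique up to $G$-equivariant homeomorphism, of which every $G$-boundary is a continuous $G$-equivariant image. A group $H$ is amenable if there is a unital positive linear functional on $\ell^\infty(H)$ that is invariant under left translation, and the amenable radical $R_a(G)$ is the largest amenable normal subgroup of $G$ (equivalently, the subgroup generated by all amenable normal subgroups). Then: (1) $\partial_F G = \partial_F(G/R_a(G))$ as $G$-spaces: there is a homeomorphism $\varphi:\partial_F G\to\partial_F(G/R_a(G))$ with $\varphi(gx)=(gR_a(G))\,\varphi(x)$ for all $g\in G$ and $x\in\partial_F G$. (2) If the action of $G$ on $\partial_F G$ is topologically free, i.e. for every $s\in G$ with $s\neq e$ the set $\{x\in\partial_F G : sx\neq x\}$ is dense in $\partial_F G$, then $R_a(G)$ is trivial. -/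

import Mathlib

open MeasureTheory Topology Filter
open scoped ComplexOrder ENNReal

universe u v w

/-- `X` is a compact (Hausdorff, nonempty) `G`-space, for the discrete group `G`. -/
structure IsCompactGSpace (G : Type u) (X : Type v) [Group G] [TopologicalSpace X]
    [MulAction G X] : Prop where
  nonempty : Nonempty X
  compactSpace : CompactSpace X
  t2Space : T2Space X
  continuousConstSMul : ContinuousConstSMul G X

/-- Strong proximality: for every regular Borel probability measure `ν` on `X`, the weak* closure
of the orbit `G ν` contains a point mass. The topology on `ProbabilityMeasure X` is the one of
convergence of the integrals of all bounded continuous functions, and `g ν` is the image of `ν`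
under `x ↦ g • x`. -/
def IsStronglyProximal (G : Type u) (X : Type v) [Group G] [TopologicalSpace X]
    [MulAction G X] : Prop :=
  letI : MeasurableSpace X := borel X
  have : BorelSpace X := ⟨rfl⟩
  ∀ ν : ProbabilityMeasure X, (ν : Measure X).Regular →
    ∃ x : X, diracProba x ∈ closure
      {μ : ProbabilityMeasure X | ∃ g : G, (μ : Measure X) = (ν : Measure X).map (fun y => g • y)}

/-- A `G`-boundary: a compact `G`-space with a minimal and strongly proximal action. -/
structure IsBoundary (G : Type u) (X : Type v) [Group G] [TopologicalSpace X]
    [MulAction G X] : Prop extends IsCompactGSpace G X where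
  isMinimal : MulAction.IsMinimal G X
  isStronglyProximal : IsStronglyProximal G X

/-- `X` is (a model of) the Furstenberg boundary of `G`: a `G`-boundary which is universal, in the
sense that every `G`-boundary is a continuous `G`-equivariant image of `X`. It suffices to test
this on boundaries `B` in the universe of `G`: see `IsFurstenbergBoundary.exists_map`. A model
exists, by `exists_isFurstenbergBoundary`. -/
structure IsFurstenbergBoundary (G : Type u) (X : Type v) [Group G] [TopologicalSpace X]
    [MulAction G X] : Prop extends IsBoundary G X where
  universal : ∀ (B : Type u) [TopologicalSpace B] [MulAction G B], IsBoundary G B →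
    ∃ f : X → B, Continuous f ∧ (∀ (g : G) (x : X), f (g • x) = g • f x) ∧ Function.Surjective f

/-- The action of `G` on `X` is topologically free. -/
def IsTopologicallyFree (G : Type u) (X : Type v) [Group G] [TopologicalSpace X]
    [MulAction G X] : Prop :=
  ∀ s : G, s ≠ 1 → Dense {x : X | s • x ≠ x}

/-- `G` is amenable: there is a unital positive linear map `m` from `ℓ^∞(G)` to `ℂ` which is
`G`-equivariant, i.e. invariant under left translation. -/
def IsAmenable (G : Type u) [Group G] : Prop :=
  ∃ m : lp (fun _ : G => ℂ) ∞ →ₗ[ℂ] ℂ,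
    m 1 = 1 ∧
    (∀ f : lp (fun _ : G => ℂ) ∞, (∀ s, 0 ≤ f s) → 0 ≤ m f) ∧
    (∀ (t : G) (f f' : lp (fun _ : G => ℂ) ∞), (∀ s, f' s = f (t⁻¹ * s)) → m f' = m f)

/-- The amenable radical: the subgroup generated by all amenable normal subgroups. It is the
largest amenable normal subgroup, by `isGreatest_amenableRadical`. -/
def amenableRadical (G : Type u) [Group G] : Subgroup G :=
  sSup {N : Subgroup G | N.Normal ∧ IsAmenable N}

instance amenableRadical_normal (G : Type u) [Group G] : (amenableRadical G).Normal :=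
  Subgroup.sSup_normal _ fun _ h => h.1

/-! ### Existence of the Furstenberg boundary -/

/-- A nonempty closed set that is invariant under a family of maps of a compact space contains a
minimal such set. -/
theorem exists_minimal_closed_invariant {ι : Type*} {Z : Type*} [TopologicalSpace Z]
    [CompactSpace Z] (T : ι → Z → Z) (C : Set Z) (hC : IsClosed C) (hne : C.Nonempty)
    (hT : ∀ i, ∀ z ∈ C, T i z ∈ C) :
    ∃ K ⊆ C, IsClosed K ∧ K.Nonempty ∧ (∀ i, ∀ z ∈ K, T i z ∈ K) ∧
      ∀ D ⊆ K, IsClosed D → D.Nonempty → (∀ i, ∀ z ∈ D, T i z ∈ D) → D = K := by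
  obtain ⟨K, hKC, hK⟩ := zorn_superset_nonempty
    {K : Set Z | IsClosed K ∧ K.Nonempty ∧ ∀ i, ∀ z ∈ K, T i z ∈ K} (by
      intro c hc hchain hcne
      refine ⟨⋂₀ c, ⟨isClosed_sInter fun s hs => (hc hs).1, ?_, ?_⟩,
        fun s hs => Set.sInter_subset_of_mem hs⟩
      · have : Nonempty c := hcne.to_subtype
        rw [Set.sInter_eq_iInter]
        refine IsCompact.nonempty_iInter_of_directed_nonempty_isCompact_isClosed _ ?_
          (fun s => (hc s.2).2.1) (fun s => (hc s.2).1.isCompact) (fun s => (hc s.2).1)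
        intro a b
        rcases hchain.total a.2 b.2 with h | h
        · exact ⟨a, le_rfl, h⟩
        · exact ⟨b, h, le_rfl⟩
      · intro i z hz s hs
        exact (hc hs).2.2 i z (hz s hs)) C ⟨hC, hne, hT⟩
  refine ⟨K, hKC, hK.prop.1, hK.prop.2.1, hK.prop.2.2, fun D hD h1 h2 h3 => ?_⟩
  exact hD.antisymm (hK.le_of_le ⟨h1, h2, h3⟩ hD)

theorem ProbabilityMeasure.mem_closure_of_integral_eq {X : Type*} [TopologicalSpace X]
    [MeasurableSpace X] [OpensMeasurableSpace X] (S : Set (ProbabilityMeasure X))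
    (μ μ' : ProbabilityMeasure X) (hμ : μ ∈ closure S)
    (h : ∀ f : BoundedContinuousFunction X ℝ, ∫ x, f x ∂(μ : Measure X) =
      ∫ x, f x ∂(μ' : Measure X)) : μ' ∈ closure S := by
  rw [mem_closure_iff_ultrafilter] at hμ ⊢
  obtain ⟨F, hF, hl⟩ := hμ
  refine ⟨F, hF, ?_⟩
  have h1 : Tendsto id (F : Filter _) (𝓝 μ) := hl
  rw [ProbabilityMeasure.tendsto_iff_forall_integral_tendsto] at h1
  have h2 : Tendsto id (F : Filter _) (𝓝 μ') := by
    rw [ProbabilityMeasure.tendsto_iff_forall_integral_tendsto]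
    intro f
    rw [← h f]
    exact h1 f
  exact h2

/-- Strong proximality, in terms of integrals: for every Borel probability measure. -/
theorem IsStronglyProximal.exists_ultrafilter {G : Type u} {X : Type v} [Group G]
    [TopologicalSpace X] [MulAction G X] [CompactSpace X] [T2Space X] [ContinuousConstSMul G X]
    [MeasurableSpace X] [BorelSpace X] (h : IsStronglyProximal G X) (ν : ProbabilityMeasure X) :
    ∃ (x : X) (F : Ultrafilter G), ∀ f : BoundedContinuousFunction X ℝ,
      Tendsto (fun g : G => ∫ y, f (g • y) ∂(ν : Measure X)) F (𝓝 (f x)) := by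
  have hm : ‹MeasurableSpace X› = borel X := BorelSpace.measurable_eq
  subst hm
  let _ : MeasurableSpace X := borel X
  have _ : BorelSpace X := ⟨rfl⟩
  obtain ⟨ν', hreg, hfin, hint⟩ := Measure.exists_regular_eq_of_compactSpace (ν : Measure X)
  have hp : IsProbabilityMeasure ν' := by
    have := hint (BoundedContinuousFunction.const X 1)
    simp only [BoundedContinuousFunction.const_apply, integral_const, probReal_univ, smul_eq_mul,
      mul_one] at this
    constructor
    rw [← ENNReal.toReal_eq_one_iff]
    exact this.symm
  obtain ⟨x, hx⟩ := h ⟨ν', hp⟩ hreg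
  rw [mem_closure_iff_ultrafilter] at hx
  obtain ⟨F, hF, hl⟩ := hx
  let c : G → ProbabilityMeasure X := fun g =>
    ProbabilityMeasure.map ⟨ν', hp⟩ (f := fun y => g • y)
      (continuous_const_smul g).measurable.aemeasurable
  have hr : Set.range c ∈ F := by
    refine mem_of_superset hF ?_
    rintro μ ⟨g, hg⟩
    refine ⟨g, Subtype.ext ?_⟩
    exact hg.symm
  obtain ⟨F', hF'⟩ : ∃ F' : Ultrafilter G, F'.map c = F := by
    have : (Filter.comap c F).NeBot := Filter.comap_neBot_iff.2 fun t ht => by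
      obtain ⟨_, h1, ⟨g, rfl⟩⟩ := F.nonempty_of_mem (Filter.inter_mem ht hr)
      exact ⟨g, h1⟩
    refine ⟨Ultrafilter.of (Filter.comap c F), ?_⟩
    refine Ultrafilter.coe_le_coe.1 ?_
    rw [Ultrafilter.coe_map]
    exact (Filter.map_mono (Ultrafilter.of_le _)).trans Filter.map_comap_le
  have ht : Tendsto c F' (𝓝 (diracProba x)) := by
    rw [Tendsto, ← Ultrafilter.coe_map, hF']
    exact hl
  rw [ProbabilityMeasure.tendsto_iff_forall_integral_tendsto] at ht
  refine ⟨x, F', fun f => ?_⟩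
  have h1 := ht f
  have h2 : ∫ ω, f ω ∂((diracProba x : ProbabilityMeasure X) : Measure X) = f x := by
    rw [show ((diracProba x : ProbabilityMeasure X) : Measure X) = Measure.dirac x from rfl]
    exact integral_dirac' _ _ f.continuous.stronglyMeasurable
  rw [h2] at h1
  refine h1.congr fun g => ?_
  have h3 : ∫ ω, f ω ∂(c g : Measure X) = ∫ ω, f (g • ω) ∂ν' := by
    rw [show (c g : Measure X) = ν'.map (fun y => g • y) from rfl]
    exact integral_map (continuous_const_smul g).measurable.aemeasurable
      f.continuous.measurable.aestronglyMeasurable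
  rw [h3]
  exact (hint (f.compContinuous ⟨fun y => g • y, continuous_const_smul g⟩)).symm

/-- A compact `G`-space that embeds in a product of strongly proximal ones is strongly proximal. -/
theorem isStronglyProximal_of_jointly_injective {G : Type u} {X : Type v} [Group G]
    [TopologicalSpace X] [MulAction G X] [CompactSpace X] [T2Space X] [ContinuousConstSMul G X]
    {ι : Type*} {B : ι → Type*} [∀ i, TopologicalSpace (B i)] [∀ i, MulAction G (B i)]
    [∀ i, CompactSpace (B i)] [∀ i, T2Space (B i)] [∀ i, ContinuousConstSMul G (B i)]
    (hB : ∀ i, IsStronglyProximal G (B i)) (p : ∀ i, X → B i) (hp : ∀ i, Continuous (p i))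
    (hpe : ∀ i (g : G) (x : X), p i (g • x) = g • p i x)
    (hinj : ∀ x y : X, (∀ i, p i x = p i y) → x = y) : IsStronglyProximal G X := by
  let : MeasurableSpace X := borel X
  have : BorelSpace X := ⟨rfl⟩
  let : ∀ i, MeasurableSpace (B i) := fun i => borel (B i)
  have : ∀ i, BorelSpace (B i) := fun i => ⟨rfl⟩
  change ∀ ν : ProbabilityMeasure X, (ν : Measure X).Regular →
    ∃ x : X, diracProba x ∈ closure
      {μ : ProbabilityMeasure X | ∃ g : G, (μ : Measure X) = (ν : Measure X).map (fun y => g • y)}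
  intro ν _
  let T : G → ProbabilityMeasure X → ProbabilityMeasure X := fun g μ =>
    μ.map (f := fun y => g • y) (continuous_const_smul g).measurable.aemeasurable
  have hTc : ∀ g, Continuous (T g) := fun g =>
    ProbabilityMeasure.continuous_map (continuous_const_smul g)
  have hTi : ∀ (g : G) (μ : ProbabilityMeasure X) (f : BoundedContinuousFunction X ℝ),
      ∫ x, f x ∂(T g μ : Measure X) = ∫ x, f (g • x) ∂(μ : Measure X) := by
    intro g μ f
    rw [show (T g μ : Measure X) = (μ : Measure X).map (fun y => g • y) from rfl]
    exact integral_map (continuous_const_smul g).measurable.aemeasurable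
      f.continuous.measurable.aestronglyMeasurable
  set S := {μ : ProbabilityMeasure X | ∃ g : G,
    (μ : Measure X) = (ν : Measure X).map (fun y => g • y)} with hS
  have hSinv : ∀ g, ∀ μ ∈ S, T g μ ∈ S := by
    rintro g μ ⟨k, hk⟩
    refine ⟨g * k, ?_⟩
    rw [show (T g μ : Measure X) = (μ : Measure X).map (fun y => g • y) from rfl, hk,
      Measure.map_map (continuous_const_smul g).measurable (continuous_const_smul k).measurable]
    congr 1
    funext y
    simp [mul_smul]
  obtain ⟨K, hKS, hKc, hKne, hKT, hKmin⟩ := exists_minimal_closed_invariant T (closure S)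
    isClosed_closure ⟨T 1 ν, subset_closure ⟨1, rfl⟩⟩ (fun g μ hμ =>
      map_mem_closure (hTc g) hμ (hSinv g))
  -- every member of `K` has point masses as its images in the `B i`
  have key : ∀ i, ∀ μ ∈ K, ∃ b : B i, ∀ f : BoundedContinuousFunction (B i) ℝ,
      ∫ x, f (p i x) ∂(μ : Measure X) = f b := by
    intro i
    let comp : BoundedContinuousFunction (B i) ℝ → BoundedContinuousFunction X ℝ :=
      fun f => f.compContinuous ⟨p i, hp i⟩
    let D : Set (ProbabilityMeasure X) := {μ | ∃ b : B i, ∀ f : BoundedContinuousFunction (B i) ℝ,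
      ∫ x, f (p i x) ∂(μ : Measure X) = f b}
    have hD : IsClosed D := by
      have h1 : IsClosed {q : ProbabilityMeasure X × B i |
          ∀ f : BoundedContinuousFunction (B i) ℝ, ∫ x, comp f x ∂(q.1 : Measure X) = f q.2} := by
        simp only [Set.ofPred_forall]
        refine isClosed_iInter fun f => isClosed_eq ?_ (f.continuous.comp continuous_snd)
        refine Continuous.comp (g := fun μ : ProbabilityMeasure X =>
          ∫ x, comp f x ∂(μ : Measure X)) ?_ continuous_fst
        exact continuous_iff_continuousAt.2 fun μ =>
          ProbabilityMeasure.tendsto_iff_forall_integral_tendsto.1 tendsto_id (comp f)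
      have h2 := isClosedMap_fst_of_compactSpace _ h1
      convert h2 using 1
      ext μ
      simp only [Set.mem_image, Prod.exists, exists_and_right, exists_eq_right]
      rfl
    have hDT : ∀ g, ∀ μ ∈ D, T g μ ∈ D := by
      rintro g μ ⟨b, hb⟩
      refine ⟨g • b, fun f => ?_⟩
      refine ((hTi g μ (comp f)).trans ?_).trans
        (hb (f.compContinuous ⟨fun y => g • y, continuous_const_smul g⟩))
      refine integral_congr_ae (Eventually.of_forall fun x => ?_)
      change f (p i (g • x)) = f (g • p i x)
      rw [hpe]
    have hKD : (K ∩ D).Nonempty := by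
      obtain ⟨μ, hμ⟩ := hKne
      obtain ⟨b, F, hF⟩ := (hB i).exists_ultrafilter
        (μ.map (f := p i) (hp i).measurable.aemeasurable)
      have hle : ∃ M, (F.map (fun g => T g μ) : Filter (ProbabilityMeasure X)) ≤ 𝓝 M :=
        ⟨_, (F.map (fun g => T g μ)).le_nhds_lim⟩
      obtain ⟨M, hM⟩ := hle
      have hM' : Tendsto (fun g => T g μ) F (𝓝 M) := hM
      refine ⟨M, hKc.mem_of_tendsto hM' (Eventually.of_forall fun g => hKT g μ hμ), b,
        fun f => ?_⟩
      have h1 := ProbabilityMeasure.tendsto_iff_forall_integral_tendsto.1 hM' (comp f)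
      refine tendsto_nhds_unique h1 ((hF f).congr fun g => ?_)
      rw [hTi]
      rw [show ((μ.map (f := p i) (hp i).measurable.aemeasurable : ProbabilityMeasure (B i)) :
        Measure (B i)) = (μ : Measure X).map (p i) from rfl]
      refine (integral_map (f := fun y => f (g • y)) (hp i).measurable.aemeasurable
        (f.continuous.comp (continuous_const_smul g)).measurable.aestronglyMeasurable).trans ?_
      refine integral_congr_ae (Eventually.of_forall fun x => ?_)
      change f (g • p i x) = f (p i (g • x))
      rw [hpe]
    have := hKmin (K ∩ D) Set.inter_subset_left (hKc.inter hD) hKD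
      (fun g μ hμ => ⟨hKT g μ hμ.1, hDT g μ hμ.2⟩)
    intro μ hμ
    rw [← this] at hμ
    exact hμ.2
  obtain ⟨M, hM⟩ := hKne
  choose b hb using fun i => key i M hM
  obtain ⟨M', hreg, hfin, hint⟩ := Measure.exists_regular_eq_of_compactSpace (M : Measure X)
  have huniv : M' Set.univ = 1 := by
    have := hint (BoundedContinuousFunction.const X 1)
    simp only [BoundedContinuousFunction.const_apply, integral_const, probReal_univ, smul_eq_mul,
      mul_one] at this
    rw [← ENNReal.toReal_eq_one_iff]
    exact this.symm
  -- compact sets away from a fibre are null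
  have hopen : ∀ i, IsOpen {x : X | p i x ≠ b i} := fun i =>
    isOpen_ne_fun (hp i) continuous_const
  have hnull : ∀ i, M' {x : X | p i x ≠ b i} = 0 := by
    intro i
    rw [(hopen i).measure_eq_iSup_isCompact]
    simp only [ENNReal.iSup_eq_zero]
    intro L hL hLc
    have hLi : IsCompact (p i '' L) := hLc.image (hp i)
    obtain ⟨φ, hφ0, hφ1, hφ⟩ := exists_continuous_zero_one_of_isClosed
      (s := {b i}) (t := p i '' L) isClosed_singleton hLi.isClosed (by
        rw [Set.disjoint_singleton_left]
        rintro ⟨x, hx, hxb⟩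
        exact hL hx hxb)
    let f : BoundedContinuousFunction (B i) ℝ := BoundedContinuousFunction.mkOfCompact φ
    have h0 : ∫ x, f (p i x) ∂M' = 0 := by
      refine (hint (f.compContinuous ⟨p i, hp i⟩)).symm.trans ((hb i f).trans ?_)
      exact hφ0 rfl
    have hint' : Integrable (fun x => f (p i x)) M' :=
      (f.compContinuous ⟨p i, hp i⟩).integrable M'
    have h0 := (integral_eq_zero_iff_of_nonneg (f := fun x => f (p i x))
      (fun x => (hφ (p i x)).1) hint').1 h0
    refine measure_mono_null (fun x hx => ?_) h0
    change ¬ (f (p i x) = 0)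
    have : f (p i x) = 1 := hφ1 ⟨x, hx, rfl⟩
    rw [this]
    exact one_ne_zero
  have hU : M' (⋃ i, {x : X | p i x ≠ b i}) = 0 := by
    rw [(isOpen_iUnion hopen).measure_eq_iSup_isCompact]
    simp only [ENNReal.iSup_eq_zero]
    intro L hL hLc
    obtain ⟨t, ht⟩ := hLc.elim_finite_subcover _ hopen hL
    refine measure_mono_null ht ?_
    exact (measure_biUnion_null_iff t.countable_toSet).2 fun i _ => hnull i
  obtain ⟨x, hx⟩ : ∃ x : X, ∀ i, p i x = b i := by
    by_contra hcon
    push Not at hcon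
    have : (⋃ i, {x : X | p i x ≠ b i}) = Set.univ :=
      Set.eq_univ_of_forall fun x => Set.mem_iUnion.2 (hcon x)
    rw [this, huniv] at hU
    exact one_ne_zero hU
  have hae : ∀ᵐ y ∂M', y = x := by
    refine measure_mono_null (fun y hy => ?_) hU
    by_contra hcon
    simp only [Set.mem_iUnion, Set.mem_ofPred_eq, not_exists, not_not] at hcon
    exact hy (hinj y x fun i => (hcon i).trans (hx i).symm)
  refine ⟨x, ProbabilityMeasure.mem_closure_of_integral_eq S M _ (hKS hM) fun f => ?_⟩
  rw [hint f, show ((diracProba x : ProbabilityMeasure X) : Measure X) = Measure.dirac x from rfl,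
    integral_dirac' _ _ f.continuous.stronglyMeasurable,
    integral_congr_ae (g := fun _ => f x) (hae.mono fun y hy => by simp only [hy])]
  simp [Measure.real, huniv]

/-- The set of indices for the product of all boundaries of `G`, up to isomorphism. -/
structure BoundaryIndex (G : Type u) [Group G] : Type u where
  carrier : Set (Ultrafilter G)
  top : TopologicalSpace carrier
  act : MulAction G carrier
  isBoundary : IsBoundary G carrier

/-- Every boundary is isomorphic to one that is carried by a set of ultrafilters on `G`. -/
theorem IsBoundary.exists_index {G : Type u} [Group G] {B : Type v} [TopologicalSpace B]
    [MulAction G B] (hB : IsBoundary G B) : ∃ i : BoundaryIndex G,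
      letI := i.top
      letI := i.act
      ∃ f : i.carrier ≃ₜ B, ∀ (g : G) (x : i.carrier), f (g • x) = g • f x := by
  have := hB.nonempty
  have := hB.compactSpace
  have := hB.t2Space
  have := hB.continuousConstSMul
  have := hB.isMinimal
  obtain ⟨b⟩ := hB.nonempty
  have hex : ∀ c : B, ∃ U : Ultrafilter G, Tendsto (fun g : G => g • b) U (𝓝 c) := by
    intro c
    have h1 : (Filter.comap (fun g : G => g • b) (𝓝 c)).NeBot :=
      Filter.comap_neBot_iff.2 fun t ht => by
        obtain ⟨g, hg⟩ := (denseRange_smul G b).exists_mem_open isOpen_interior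
          ⟨c, mem_interior_iff_mem_nhds.2 ht⟩
        exact ⟨g, interior_subset hg⟩
    exact ⟨Ultrafilter.of _, (Filter.map_mono (Ultrafilter.of_le _)).trans Filter.map_comap_le⟩
  choose U hU using hex
  have hinj : Function.Injective U := fun c d h =>
    tendsto_nhds_unique (hU c) (h ▸ hU d)
  let e : Set.range U ≃ B := (Equiv.ofInjective U hinj).symm
  let t : TopologicalSpace (Set.range U) := TopologicalSpace.induced e inferInstance
  let a : MulAction G (Set.range U) := e.mulAction G
  let h : Set.range U ≃ₜ B := e.toHomeomorphOfIsInducing ⟨rfl⟩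
  have he : ∀ (g : G) (x : Set.range U), h (g • x) = g • h x := fun g x =>
    e.apply_symm_apply _
  have c1 : CompactSpace (Set.range U) := h.symm.compactSpace
  have c2 : T2Space (Set.range U) := h.symm.t2Space
  have c3 : ContinuousConstSMul G (Set.range U) := ⟨fun g => by
    rw [← h.comp_continuous_iff]
    refine ((continuous_const_smul g).comp h.continuous).congr fun x => (he g x).symm⟩
  refine ⟨⟨Set.range U, t, a, ⟨⟨⟨h.symm b⟩, c1, c2, c3⟩, ⟨fun x => ?_⟩, ?_⟩⟩, h, he⟩
  · refine (h.symm.surjective.denseRange.comp (denseRange_smul G (h x))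
      h.symm.continuous).mono ?_
    rintro _ ⟨g, rfl⟩
    exact ⟨g, h.injective ((he g x).trans (h.apply_symm_apply _).symm)⟩
  · exact isStronglyProximal_of_jointly_injective (ι := Unit) (B := fun _ => B)
      (fun _ => hB.isStronglyProximal) (fun _ => h) (fun _ => h.continuous) (fun _ => he)
      (fun x y hxy => h.injective (hxy ()))

/-- Every group has a Furstenberg boundary. -/
theorem exists_isFurstenbergBoundary (G : Type u) [Group G] :
    ∃ (X : Type u) (_ : TopologicalSpace X) (_ : MulAction G X), IsFurstenbergBoundary G X := by
  let _ : ∀ i : BoundaryIndex G, TopologicalSpace i.carrier := fun i => i.top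
  let _ : ∀ i : BoundaryIndex G, MulAction G i.carrier := fun i => i.act
  have _ : ∀ i : BoundaryIndex G, CompactSpace i.carrier := fun i => i.isBoundary.compactSpace
  have _ : ∀ i : BoundaryIndex G, T2Space i.carrier := fun i => i.isBoundary.t2Space
  have _ : ∀ i : BoundaryIndex G, Nonempty i.carrier := fun i => i.isBoundary.nonempty
  have _ : ∀ i : BoundaryIndex G, ContinuousConstSMul G i.carrier :=
    fun i => i.isBoundary.continuousConstSMul
  let P : Type u := ∀ i : BoundaryIndex G, i.carrier
  obtain ⟨K, -, hKc, hKne, hKT, hKmin⟩ := exists_minimal_closed_invariant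
    (fun (g : G) (x : P) => g • x) Set.univ isClosed_univ Set.univ_nonempty
    (fun _ _ _ => Set.mem_univ _)
  let X : SubMulAction G P := ⟨K, fun g x hx => hKT g x hx⟩
  have : Nonempty X := hKne.to_subtype
  have : CompactSpace X := isCompact_iff_compactSpace.1 hKc.isCompact
  have : T2Space X := inferInstanceAs (T2Space K)
  have : ContinuousConstSMul G X := ⟨fun g => by
    refine Continuous.subtype_mk (f := fun x : X => g • (x : P)) ?_ _
    exact (continuous_const_smul g).comp continuous_subtype_val⟩
  have hmin : MulAction.IsMinimal G X := by
    refine ⟨fun x => ?_⟩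
    have h1 := hKmin (Subtype.val '' closure (MulAction.orbit G x))
      (by rintro _ ⟨y, -, rfl⟩; exact y.2)
      ((isClosed_closure.isCompact.image continuous_subtype_val).isClosed)
      (((MulAction.nonempty_orbit x).mono subset_closure).image _) (by
        rintro g _ ⟨y, hy, rfl⟩
        refine ⟨g • y, map_mem_closure (continuous_const_smul g) hy fun z hz => ?_, rfl⟩
        exact MulAction.mem_orbit_of_mem_orbit g hz)
    intro y
    obtain ⟨z, hz, hzy⟩ := h1.ge y.2
    rwa [← Subtype.ext hzy]
  have hb : IsBoundary G X := ⟨⟨inferInstance, inferInstance, inferInstance, inferInstance⟩, hmin,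
    isStronglyProximal_of_jointly_injective (fun i : BoundaryIndex G =>
      i.isBoundary.isStronglyProximal) (fun i x => x.1 i)
      (fun i => (continuous_apply i).comp continuous_subtype_val) (fun _ _ _ => rfl)
      (fun x y h => Subtype.ext (funext h))⟩
  refine ⟨X, inferInstance, inferInstance, hb, fun B _ _ hB => ?_⟩
  obtain ⟨i, f, hf⟩ := hB.exists_index
  have := hB.t2Space
  have := hB.isMinimal
  have hc : Continuous fun x : X => f (x.1 i) :=
    f.continuous.comp ((continuous_apply i).comp continuous_subtype_val)
  have he : ∀ (g : G) (x : X), f ((g • x).1 i) = g • f (x.1 i) := fun g x => hf g (x.1 i)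
  refine ⟨fun x => f (x.1 i), hc, he, ?_⟩
  rw [← Set.range_eq_univ]
  obtain ⟨x₀⟩ := ‹Nonempty X›
  refine (isCompact_range hc).isClosed.closure_eq ▸ (Dense.mono ?_
    (MulAction.dense_orbit G (f (x₀.1 i)))).closure_eq
  rintro _ ⟨g, rfl⟩
  exact ⟨g • x₀, he g x₀⟩

/-- The universal property holds for boundaries in every universe. -/
theorem IsFurstenbergBoundary.exists_map {G : Type u} [Group G] {X : Type v} [TopologicalSpace X]
    [MulAction G X] (hX : IsFurstenbergBoundary G X) (B : Type w) [TopologicalSpace B]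
    [MulAction G B] (hB : IsBoundary G B) :
    ∃ f : X → B, Continuous f ∧ (∀ (g : G) (x : X), f (g • x) = g • f x) ∧
      Function.Surjective f := by
  obtain ⟨i, f, hf⟩ := hB.exists_index
  let _ := i.top
  let _ := i.act
  obtain ⟨p, hp, hpe, hps⟩ := hX.universal i.carrier i.isBoundary
  exact ⟨f ∘ p, f.continuous.comp hp, fun g x => by simp only [Function.comp_apply, hpe, hf],
    f.surjective.comp hps⟩

/-! ### The amenable radical is amenable -/

/-- A bounded function as an element of `ℓ^∞`. -/
def boundedFun {S : Type*} (f : S → ℂ) (C : ℝ) (h : ∀ s, ‖f s‖ ≤ C) :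
    lp (fun _ : S => ℂ) ∞ :=
  ⟨f, memℓp_infty ⟨C, by rintro _ ⟨s, rfl⟩; exact h s⟩⟩

/-- Left translation on `ℓ^∞(G)`. -/
noncomputable def leftTranslate {G : Type*} [Group G] (t : G) (f : lp (fun _ : G => ℂ) ∞) :
    lp (fun _ : G => ℂ) ∞ :=
  boundedFun (fun s => f (t⁻¹ * s)) ‖f‖ fun s => lp.norm_apply_le_norm (by simp) f (t⁻¹ * s)

/-- A mean on `ℓ^∞(S)`: a unital positive linear functional. -/
structure IsMean {S : Type*} (m : lp (fun _ : S => ℂ) ∞ →ₗ[ℂ] ℂ) : Prop where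
  one : m 1 = 1
  pos : ∀ f : lp (fun _ : S => ℂ) ∞, (∀ s, 0 ≤ f s) → 0 ≤ m f

theorem IsMean.bound_real {S : Type*} {m : lp (fun _ : S => ℂ) ∞ →ₗ[ℂ] ℂ} (hm : IsMean m)
    (f : lp (fun _ : S => ℂ) ∞) (C : ℝ) (h : ∀ s, ∃ r : ℝ, f s = r ∧ |r| ≤ C) : ‖m f‖ ≤ C := by
  have h1 := hm.pos ((C : ℂ) • 1 - f) fun s => by
    obtain ⟨r, hr, hC⟩ := h s
    have : ((C : ℂ) • (1 : lp (fun _ : S => ℂ) ∞) - f) s = ((C - r : ℝ) : ℂ) := by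
      change (C : ℂ) * 1 - f s = _
      simp [hr]
    rw [this, Complex.zero_le_real]
    linarith [le_abs_self r]
  have h2 := hm.pos ((C : ℂ) • 1 + f) fun s => by
    obtain ⟨r, hr, hC⟩ := h s
    have : ((C : ℂ) • (1 : lp (fun _ : S => ℂ) ∞) + f) s = ((C + r : ℝ) : ℂ) := by
      change (C : ℂ) * 1 + f s = _
      simp [hr]
    rw [this, Complex.zero_le_real]
    linarith [neg_abs_le r]
  rw [map_sub, map_smul, hm.one, smul_eq_mul, mul_one, Complex.le_def] at h1
  rw [map_add, map_smul, hm.one, smul_eq_mul, mul_one, Complex.le_def] at h2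
  simp only [Complex.zero_re, Complex.zero_im, Complex.sub_re, Complex.sub_im, Complex.add_re,
    Complex.add_im, Complex.ofReal_re, Complex.ofReal_im] at h1 h2
  have h3 : m f = ((m f).re : ℂ) := Complex.ext rfl (by simp; linarith [h1.2])
  rw [h3, Complex.norm_real, Real.norm_eq_abs, abs_le]
  constructor <;> linarith [h1.1, h2.1]

theorem IsMean.bound {S : Type*} {m : lp (fun _ : S => ℂ) ∞ →ₗ[ℂ] ℂ} (hm : IsMean m)
    (f : lp (fun _ : S => ℂ) ∞) : ‖m f‖ ≤ 2 * ‖f‖ := by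
  have hf : ∀ s, ‖f s‖ ≤ ‖f‖ := fun s => lp.norm_apply_le_norm (by simp) f s
  let a := boundedFun (fun s => ((f s).re : ℂ)) ‖f‖ fun s => by
    rw [Complex.norm_real]; exact (Complex.abs_re_le_norm _).trans (hf s)
  let b := boundedFun (fun s => ((f s).im : ℂ)) ‖f‖ fun s => by
    rw [Complex.norm_real]; exact (Complex.abs_im_le_norm _).trans (hf s)
  have hab : f = a + Complex.I • b := by
    refine lp.ext (funext fun s => ?_)
    change f s = ((f s).re : ℂ) + Complex.I * ((f s).im : ℂ)
    rw [mul_comm, Complex.re_add_im]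
  have ha : ‖m a‖ ≤ ‖f‖ := hm.bound_real a _ fun s =>
    ⟨_, rfl, (Complex.abs_re_le_norm _).trans (hf s)⟩
  have hb : ‖m b‖ ≤ ‖f‖ := hm.bound_real b _ fun s =>
    ⟨_, rfl, (Complex.abs_im_le_norm _).trans (hf s)⟩
  calc ‖m f‖ = ‖m a + Complex.I * m b‖ := by
        conv_lhs => rw [hab, map_add, map_smul, smul_eq_mul]
    _ ≤ ‖m a‖ + ‖Complex.I * m b‖ := norm_add_le _ _
    _ ≤ 2 * ‖f‖ := by rw [norm_mul, Complex.norm_I, one_mul]; linarith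

theorem leftTranslate_mul {G : Type*} [Group G] (s t : G) (f : lp (fun _ : G => ℂ) ∞) :
    leftTranslate (s * t) f = leftTranslate s (leftTranslate t f) := by
  refine lp.ext (funext fun x => ?_)
  change f ((s * t)⁻¹ * x) = f (t⁻¹ * (s⁻¹ * x))
  rw [mul_inv_rev, mul_assoc]

theorem leftTranslate_one {G : Type*} [Group G] (f : lp (fun _ : G => ℂ) ∞) :
    leftTranslate 1 f = f := by
  refine lp.ext (funext fun x => ?_)
  change f (1⁻¹ * x) = f x
  rw [inv_one, one_mul]

theorem norm_leftTranslate_le {G : Type*} [Group G] (t : G) (f : lp (fun _ : G => ℂ) ∞) :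
    ‖leftTranslate t f‖ ≤ ‖f‖ :=
  lp.norm_le_of_forall_le (norm_nonneg _) fun s =>
    lp.norm_apply_le_norm (by simp) f (t⁻¹ * s)

theorem isAmenable_iff (G : Type u) [Group G] : IsAmenable G ↔
    ∃ m : lp (fun _ : G => ℂ) ∞ →ₗ[ℂ] ℂ, IsMean m ∧ ∀ t f, m (leftTranslate t f) = m f := by
  constructor
  · rintro ⟨m, h1, h2, h3⟩
    exact ⟨m, ⟨h1, h2⟩, fun t f => h3 t f _ fun s => rfl⟩
  · rintro ⟨m, h1, h2⟩
    refine ⟨m, h1.one, h1.pos, fun t f f' h => ?_⟩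
    rw [show f' = leftTranslate t f from lp.ext (funext h), h2]

/-- Averaging a mean over an amenable subgroup. -/
theorem exists_average {G : Type u} [Group G] (N : Subgroup G) (hN : IsAmenable N)
    (m : lp (fun _ : G => ℂ) ∞ →ₗ[ℂ] ℂ) (hm : IsMean m) :
    ∃ m' : lp (fun _ : G => ℂ) ∞ →ₗ[ℂ] ℂ, IsMean m' ∧
      (∀ t ∈ N, ∀ f, m' (leftTranslate t f) = m' f) ∧
      ∀ H : Subgroup G, H.Normal → (∀ t ∈ H, ∀ f, m (leftTranslate t f) = m f) →
        ∀ t ∈ H, ∀ f, m' (leftTranslate t f) = m' f := by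
  obtain ⟨μ, hμ, hinv⟩ := (isAmenable_iff N).1 hN
  let A : lp (fun _ : G => ℂ) ∞ →ₗ[ℂ] lp (fun _ : N => ℂ) ∞ :=
    { toFun := fun f => boundedFun (fun n : N => m (leftTranslate (n : G)⁻¹ f)) (2 * ‖f‖)
        fun n => (hm.bound _).trans (by linarith [norm_leftTranslate_le (n : G)⁻¹ f])
      map_add' := fun f g => lp.ext (funext fun n => map_add m
        (leftTranslate (n : G)⁻¹ f) (leftTranslate (n : G)⁻¹ g))
      map_smul' := fun c f => lp.ext (funext fun n => map_smul m c
        (leftTranslate (n : G)⁻¹ f)) }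
  have hA : ∀ f (n : N), A f n = m (leftTranslate (n : G)⁻¹ f) := fun f n => rfl
  refine ⟨μ ∘ₗ A, ⟨?_, ?_⟩, ?_, ?_⟩
  · have : A 1 = 1 := lp.ext (funext fun n => hm.one)
    rw [LinearMap.comp_apply, this, hμ.one]
  · intro f hf
    exact hμ.pos _ fun n => hm.pos _ fun s => hf _
  · intro t ht f
    rw [LinearMap.comp_apply, LinearMap.comp_apply, ← hinv ⟨t, ht⟩ (A f)]
    congr 1
    refine lp.ext (funext fun n => ?_)
    change m (leftTranslate (n : G)⁻¹ (leftTranslate t f)) =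
      m (leftTranslate (t⁻¹ * (n : G))⁻¹ f)
    rw [← leftTranslate_mul, mul_inv_rev, inv_inv]
  · intro H hH hmH t ht f
    rw [LinearMap.comp_apply, LinearMap.comp_apply]
    congr 1
    refine lp.ext (funext fun n => ?_)
    rw [hA, hA, ← leftTranslate_mul, show (n : G)⁻¹ * t = ((n : G)⁻¹ * t * n) * (n : G)⁻¹ by group,
      leftTranslate_mul]
    refine hmH _ ?_ _
    have := hH.conj_mem t ht (n : G)⁻¹
    rwa [inv_inv] at this

/-- An amenable subgroup, from a mean on the whole group. -/
theorem isAmenable_of_invariant_mean {G : Type u} [Group G] (R : Subgroup G)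
    (m : lp (fun _ : G => ℂ) ∞ →ₗ[ℂ] ℂ) (hm : IsMean m)
    (h : ∀ t ∈ R, ∀ f, m (leftTranslate t f) = m f) : IsAmenable R := by
  let τ : G → G := fun s => (Quotient.mk (QuotientGroup.rightRel R) s).out
  have hτ : ∀ s, s * (τ s)⁻¹ ∈ R := fun s =>
    QuotientGroup.rightRel_apply.1 (Quotient.mk_out (s := QuotientGroup.rightRel R) s)
  have hτ' : ∀ (r : R) (s : G), τ (r * s) = τ s := fun r s => by
    have : Quotient.mk (QuotientGroup.rightRel R) (r * s) =
        Quotient.mk (QuotientGroup.rightRel R) s := by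
      refine Quotient.sound (QuotientGroup.rightRel_apply.2 ?_)
      rw [mul_inv_rev, mul_inv_cancel_left]
      exact R.inv_mem r.2
    simp only [τ, this]
  let ρ : G → R := fun s => ⟨s * (τ s)⁻¹, hτ s⟩
  let E : lp (fun _ : R => ℂ) ∞ →ₗ[ℂ] lp (fun _ : G => ℂ) ∞ :=
    { toFun := fun f => boundedFun (fun s => f (ρ s)) ‖f‖
        fun s => lp.norm_apply_le_norm (by simp) f (ρ s)
      map_add' := fun f g => lp.ext (funext fun n => rfl)
      map_smul' := fun c f => lp.ext (funext fun n => rfl) }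
  refine (isAmenable_iff R).2 ⟨m ∘ₗ E, ⟨?_, fun f hf => hm.pos _ fun s => hf _⟩, fun t f => ?_⟩
  · have : E 1 = 1 := lp.ext (funext fun n => rfl)
    rw [LinearMap.comp_apply, this, hm.one]
  · rw [LinearMap.comp_apply, LinearMap.comp_apply, ← h t t.2 (E f)]
    congr 1
    refine lp.ext (funext fun s => ?_)
    change f (t⁻¹ * ρ s) = f (ρ ((t : G)⁻¹ * s))
    refine congrArg f (Subtype.ext ?_)
    change (t : G)⁻¹ * (s * (τ s)⁻¹) = (t : G)⁻¹ * s * (τ ((t : G)⁻¹ * s))⁻¹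
    have := hτ' t⁻¹ s
    rw [Subgroup.coe_inv] at this
    rw [this, mul_assoc]

/-- The amenable radical is the largest amenable normal subgroup. -/
theorem isGreatest_amenableRadical (G : Type u) [Group G] :
    IsGreatest {N : Subgroup G | N.Normal ∧ IsAmenable N} (amenableRadical G) := by
  classical
  refine ⟨⟨inferInstance, ?_⟩, fun N hN => le_sSup hN⟩
  let 𝒩 := {N : Subgroup G // N.Normal ∧ IsAmenable N}
  have hfin : ∀ F : Finset 𝒩, ∃ m : lp (fun _ : G => ℂ) ∞ →ₗ[ℂ] ℂ, IsMean m ∧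
      ∀ N ∈ F, ∀ t ∈ N.1, ∀ f, m (leftTranslate t f) = m f := by
    intro F
    induction F using Finset.induction_on with
    | empty =>
      refine ⟨{ toFun := fun f => f 1, map_add' := fun _ _ => rfl, map_smul' := fun _ _ => rfl },
        ⟨rfl, fun f hf => hf 1⟩, fun N hN => absurd hN (Finset.notMem_empty N)⟩
    | insert N F _ ih =>
      obtain ⟨m, hm, hmF⟩ := ih
      obtain ⟨m', hm', h1, h2⟩ := exists_average N.1 N.2.2 m hm
      refine ⟨m', hm', fun N' hN' => ?_⟩
      rcases Finset.mem_insert.1 hN' with rfl | hN'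
      · exact h1
      · exact h2 N'.1 N'.2.1 (hmF N' hN')
  choose m hm hmF using hfin
  let U : Ultrafilter (Finset 𝒩) := Ultrafilter.of atTop
  have hlim : ∀ f, ∃ c, Tendsto (fun F => m F f) U (𝓝 c) := fun f => by
    obtain ⟨c, -, hc⟩ := (isCompact_closedBall (0 : ℂ) (2 * ‖f‖)).ultrafilter_le_nhds'
      (U.map fun F => m F f) (Ultrafilter.mem_map.2 (Filter.univ_mem' fun F =>
        mem_closedBall_zero_iff.2 ((hm F).bound f)))
    exact ⟨c, hc⟩
  choose L hL using hlim
  let M : lp (fun _ : G => ℂ) ∞ →ₗ[ℂ] ℂ :=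
    { toFun := L
      map_add' := fun f g => tendsto_nhds_unique (hL (f + g))
        (((hL f).add (hL g)).congr fun F => (map_add (m F) f g).symm)
      map_smul' := fun c f => tendsto_nhds_unique (hL (c • f))
        (((hL f).const_smul c).congr fun F => (map_smul (m F) c f).symm) }
  have hM : IsMean M := by
    refine ⟨tendsto_nhds_unique (hL 1) (tendsto_const_nhds.congr fun F => (hm F).one.symm),
      fun f hf => ?_⟩
    exact ge_of_tendsto' (hL f) fun F => (hm F).pos f hf
  let H : Subgroup G :=
    { carrier := {t | ∀ f, M (leftTranslate t f) = M f}
      mul_mem' := fun {a b} ha hb f => by rw [leftTranslate_mul, ha, hb]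
      one_mem' := fun f => by rw [leftTranslate_one]
      inv_mem' := fun {a} ha f => by
        rw [← ha (leftTranslate a⁻¹ f), ← leftTranslate_mul, mul_inv_cancel, leftTranslate_one] }
  have hH : amenableRadical G ≤ H := by
    refine sSup_le fun N hN t ht f => ?_
    refine tendsto_nhds_unique (hL (leftTranslate t f)) ((hL f).congr' ?_)
    have : ∀ᶠ F in (U : Filter (Finset 𝒩)), ({⟨N, hN⟩} : Finset 𝒩) ≤ F :=
      Ultrafilter.of_le atTop (eventually_ge_atTop _)
    filter_upwards [this] with F hF
    exact (hmF F ⟨N, hN⟩ (hF (Finset.mem_singleton_self _)) t ht f).symm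
  exact isAmenable_of_invariant_mean _ M hM fun t ht => hH ht

/-! Everything rests on one fact, `IsBoundary.smul_eq_of_amenable`: an amenable normal subgroup `N`
fixes every point of every boundary `X`. Amenability gives an `N`-invariant probability measure `ν`
on `X`, obtained by averaging functions along an orbit. Since `N` is normal, each translate `g ν` is
again `N`-invariant, and invariance survives weak* limits. Strong proximality produces a point mass
among these limits, and its support is a point fixed by `N`. By normality again, the points fixed by
`N` form a closed `G`-invariant set, so by minimality they are all of `X`. This applies to `R_a(G)`
because the radical is itself amenable (`isGreatest_amenableRadical`).

Part (2) follows at once: a nontrivial element of the radical would move no point, whereas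
topological freeness makes it move a dense set of points.

For part (1), the action of `G` on its Furstenberg boundary factors through the quotient, and being
a boundary depends only on which homeomorphisms act (`isBoundary_iff_of_surjective`). Hence each of
the two spaces is a boundary for both groups, and the two universal properties give equivariant maps
in both directions. These are mutually inverse because equivariant maps into a boundary are unique
(`IsBoundary.equivariant_map_unique`), which is a consequence of proximality. -/

/-! ### Uniqueness of equivariant maps into a boundary -/

/-- Boundaries are proximal: any two points are carried to a common limit by the action. -/
theorem IsBoundary.exists_tendsto_pair {G : Type u} {B : Type v} [Group G] [TopologicalSpace B]
    [MulAction G B] (hB : IsBoundary G B) (y z : B) :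
    ∃ (b : B) (F : Ultrafilter G), Tendsto (fun g : G => g • y) F (𝓝 b) ∧
      Tendsto (fun g : G => g • z) F (𝓝 b) := by
  have := hB.compactSpace
  have := hB.t2Space
  have := hB.continuousConstSMul
  let : MeasurableSpace B := borel B
  have : BorelSpace B := ⟨rfl⟩
  -- Strong proximality is applied to the midpoint of the two point masses. A point mass is an
  -- extreme point, so if the translated midpoints tend to one, both halves must tend to it.
  have hp : IsProbabilityMeasure ((2⁻¹ : ℝ≥0∞) • (Measure.dirac y + Measure.dirac z)) := ⟨by
    simp [ENNReal.inv_two_add_inv_two]⟩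
  obtain ⟨b, F, hF⟩ := hB.isStronglyProximal.exists_ultrafilter ⟨_, hp⟩
  have hF' : ∀ f : BoundedContinuousFunction B ℝ,
      Tendsto (fun g : G => 2⁻¹ * (f (g • y) + f (g • z))) F (𝓝 (f b)) := by
    intro f
    refine (hF f).congr fun g => ?_
    have hf : StronglyMeasurable fun x => f (g • x) :=
      (f.continuous.comp (continuous_const_smul g)).stronglyMeasurable
    have hi : ∀ w, Integrable (fun x => f (g • x)) (Measure.dirac w) := fun w =>
      (f.compContinuous ⟨fun x => g • x, continuous_const_smul g⟩).integrable _
    rw [ProbabilityMeasure.coe_mk, integral_smul_measure, integral_add_measure (hi y) (hi z),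
      integral_dirac' _ _ hf, integral_dirac' _ _ hf]
    simp
  obtain ⟨c, hc⟩ : ∃ c, Tendsto (fun g : G => g • y) F (𝓝 c) :=
    ⟨_, (F.map fun g => g • y).le_nhds_lim⟩
  obtain ⟨d, hd⟩ : ∃ d, Tendsto (fun g : G => g • z) F (𝓝 d) :=
    ⟨_, (F.map fun g => g • z).le_nhds_lim⟩
  have hval : ∀ f : BoundedContinuousFunction B ℝ, 2⁻¹ * (f c + f d) = f b := fun f =>
    tendsto_nhds_unique ((((f.continuous.tendsto c).comp hc).add
      ((f.continuous.tendsto d).comp hd)).const_mul _) (hF' f)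
  -- If `t ≠ b`, a Urysohn function with `φ b = 0`, `φ t = 1` and `φ ≥ 0` has average at least `1/2`
  -- over `c` and `d`, contradicting `hval`.
  have key : ∀ t ∈ ({c, d} : Set B), t = b := by
    intro t ht
    by_contra hne
    obtain ⟨φ, hφ0, hφ1, hφ⟩ := exists_continuous_zero_one_of_isClosed
      (s := {b}) (t := {t}) isClosed_singleton isClosed_singleton
      (Set.disjoint_singleton.2 (Ne.symm hne))
    have h := hval (BoundedContinuousFunction.mkOfCompact φ)
    simp only [BoundedContinuousFunction.mkOfCompact_apply] at h
    have h0 : φ b = 0 := hφ0 rfl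
    have h1 : φ t = 1 := hφ1 rfl
    have hc0 := (hφ c).1
    have hd0 := (hφ d).1
    rcases ht with rfl | rfl <;> linarith
  exact ⟨b, F, key c (by simp) ▸ hc, key d (by simp) ▸ hd⟩

/-- Two continuous equivariant maps from a minimal compact space to a boundary are equal. -/
theorem IsBoundary.equivariant_map_unique {G : Type u} {X : Type v} {B : Type w} [Group G]
    [TopologicalSpace X] [MulAction G X] [CompactSpace X] [MulAction.IsMinimal G X]
    [ContinuousConstSMul G X] [TopologicalSpace B] [MulAction G B] (hB : IsBoundary G B)
    {f₁ f₂ : X → B} (hf₁ : Continuous f₁) (hf₂ : Continuous f₂)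
    (he₁ : ∀ (g : G) (x : X), f₁ (g • x) = g • f₁ x)
    (he₂ : ∀ (g : G) (x : X), f₂ (g • x) = g • f₂ x) (x : X) : f₁ x = f₂ x := by
  have := hB.t2Space
  obtain ⟨b, F, h₁, h₂⟩ := hB.exists_tendsto_pair (f₁ x) (f₂ x)
  -- The ultrafilter that merges `f₁ x` and `f₂ x` also moves `x` to some limit `c`, where the two
  -- maps agree. The set of agreement is then closed, invariant and nonempty, so minimality makes it
  -- the whole space.
  obtain ⟨c, hc⟩ : ∃ c, Tendsto (fun g : G => g • x) F (𝓝 c) :=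
    ⟨_, (F.map fun g => g • x).le_nhds_lim⟩
  have h₁' : f₁ c = b := tendsto_nhds_unique ((hf₁.tendsto c).comp hc)
    (h₁.congr fun g => (he₁ g x).symm)
  have h₂' : f₂ c = b := tendsto_nhds_unique ((hf₂.tendsto c).comp hc)
    (h₂.congr fun g => (he₂ g x).symm)
  have huniv := (eq_empty_or_univ_of_smul_invariant_closed G (isClosed_eq hf₁ hf₂) (by
    rintro g _ ⟨y, hy, rfl⟩
    change f₁ (g • y) = f₂ (g • y)
    rw [he₁, he₂, show f₁ y = f₂ y from hy])).resolve_left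
      (Set.nonempty_iff_ne_empty.1 ⟨c, h₁'.trans h₂'.symm⟩)
  exact (huniv ▸ Set.mem_univ x : x ∈ {y | f₁ y = f₂ y})

/-! ### Amenable groups have invariant measures -/

/-- An amenable group acting on a compact space has an invariant probability measure. -/
theorem IsAmenable.exists_invariant_measure {H : Type u} [Group H] (hH : IsAmenable H)
    {X : Type v} [TopologicalSpace X] [CompactSpace X] [T2Space X] [Nonempty X] [MulAction H X]
    [ContinuousConstSMul H X] [MeasurableSpace X] [BorelSpace X] :
    ∃ ν : ProbabilityMeasure X, ∀ (h : H) (f : BoundedContinuousFunction X ℝ),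
      ∫ x, f (h • x) ∂(ν : Measure X) = ∫ x, f x ∂(ν : Measure X) := by
  obtain ⟨m, hm, hinv⟩ := (isAmenable_iff H).1 hH
  obtain ⟨x₀⟩ := ‹Nonempty X›
  -- Restriction of functions to the orbit of `x₀` turns the mean on `ℓ^∞(H)` into a positive
  -- functional on `C(X)`, and the Riesz representation theorem turns that into a measure. Since `X`
  -- is compact, every continuous function has compact support.
  let E : CompactlySupportedContinuousMap X ℝ → lp (fun _ : H => ℂ) ∞ := fun f =>
    boundedFun (fun s => (f (s • x₀) : ℂ))
      ‖BoundedContinuousFunction.mkOfCompact (f : C(X, ℝ))‖ fun s => by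
        rw [Complex.norm_real]
        exact (BoundedContinuousFunction.mkOfCompact (f : C(X, ℝ))).norm_coe_le_norm (s • x₀)
  let Λ₀ : CompactlySupportedContinuousMap X ℝ →ₗ[ℝ] ℝ :=
    { toFun := fun f => (m (E f)).re
      map_add' := fun f g => by
        have : E (f + g) = E f + E g := lp.ext (funext fun s => Complex.ofReal_add _ _)
        rw [this, map_add, Complex.add_re]
      map_smul' := fun c f => by
        have : E (c • f) = (c : ℂ) • E f := lp.ext (funext fun s => Complex.ofReal_mul _ _)
        rw [this, map_smul, smul_eq_mul, Complex.re_ofReal_mul]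
        rfl }
  let Λ : CompactlySupportedContinuousMap X ℝ →ₚ[ℝ] ℝ := PositiveLinearMap.mk₀ Λ₀ fun f hf =>
    (Complex.le_def.1 (hm.pos (E f) fun s => Complex.zero_le_real.2 (hf (s • x₀)))).1
  have hΛ : ∀ f, Λ f = (m (E f)).re := fun _ => rfl
  let cc : BoundedContinuousFunction X ℝ → CompactlySupportedContinuousMap X ℝ := fun f =>
    { toFun := f
      hasCompactSupport' := HasCompactSupport.of_compactSpace _ }
  have hint : ∀ f : BoundedContinuousFunction X ℝ,
      ∫ x, f x ∂(RealRMK.rieszMeasure Λ) = (m (E (cc f))).re := fun f =>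
    RealRMK.integral_rieszMeasure Λ (cc f)
  have hp : IsProbabilityMeasure (RealRMK.rieszMeasure Λ) := by
    have h1 := hint (BoundedContinuousFunction.const X 1)
    have h2 : E (cc (BoundedContinuousFunction.const X 1)) = 1 :=
      lp.ext (funext fun s => Complex.ofReal_one)
    rw [h2, hm.one] at h1
    simp only [BoundedContinuousFunction.const_apply, integral_const, smul_eq_mul, mul_one,
      Complex.one_re] at h1
    exact ⟨(ENNReal.toReal_eq_one_iff _).1 h1⟩
  refine ⟨⟨_, hp⟩, fun h f => ?_⟩
  refine (hint (f.compContinuous ⟨fun x => h • x, continuous_const_smul h⟩)).trans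
    (Eq.trans ?_ (hint f).symm)
  -- Left translation by `t` evaluates at `t⁻¹ * s`, so the function `s ↦ f (h • s • x₀)` is the
  -- translate by `h⁻¹`.
  rw [← hinv h⁻¹ (E (cc f))]
  congr 2
  refine lp.ext (funext fun s => ?_)
  change ((f (h • s • x₀) : ℝ) : ℂ) = ((f ((h⁻¹⁻¹ * s) • x₀) : ℝ) : ℂ)
  rw [inv_inv, mul_smul]

/-- An amenable normal subgroup acts trivially on every boundary. -/
theorem IsBoundary.smul_eq_of_amenable {G : Type u} {X : Type v} [Group G] [TopologicalSpace X]
    [MulAction G X] (hX : IsBoundary G X) {N : Subgroup G} (hN : N.Normal) (hA : IsAmenable N)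
    {r : G} (hr : r ∈ N) (x : X) : r • x = x := by
  have := hX.nonempty
  have := hX.compactSpace
  have := hX.t2Space
  have := hX.continuousConstSMul
  have := hX.isMinimal
  let : MeasurableSpace X := borel X
  have : BorelSpace X := ⟨rfl⟩
  have : ContinuousConstSMul N X := ⟨fun n => continuous_const_smul (n : G)⟩
  obtain ⟨ν, hν⟩ := hA.exists_invariant_measure (X := X)
  obtain ⟨c, F, hF⟩ := hX.isStronglyProximal.exists_ultrafilter ν
  -- `g ν` is `N`-invariant, since `n g = g (g⁻¹ n g)` with `g⁻¹ n g ∈ N`. The limiting point mass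
  -- at `c` is therefore `N`-invariant too, and continuous functions separate points.
  have hfix : ∀ n ∈ N, n • c = c := by
    intro n hn
    have hval : ∀ f : BoundedContinuousFunction X ℝ, f (n • c) = f c := by
      intro f
      refine tendsto_nhds_unique
        (hF (f.compContinuous ⟨fun y => n • y, continuous_const_smul n⟩)) ((hF f).congr fun g => ?_)
      have hmem : g⁻¹ * n * g ∈ N := by
        simpa using hN.conj_mem n hn g⁻¹
      refine (hν ⟨_, hmem⟩
        (f.compContinuous ⟨fun y => g • y, continuous_const_smul g⟩)).symm.trans ?_
      refine integral_congr_ae (Eventually.of_forall fun y => ?_)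
      change f (g • (g⁻¹ * n * g) • y) = f (n • g • y)
      rw [smul_smul, smul_smul]
      congr 2
      group
    by_contra hne
    obtain ⟨φ, hφ0, hφ1, -⟩ := exists_continuous_zero_one_of_isClosed
      (s := {n • c}) (t := {c}) isClosed_singleton isClosed_singleton
      (Set.disjoint_singleton.2 hne)
    have h := hval (BoundedContinuousFunction.mkOfCompact φ)
    simp only [BoundedContinuousFunction.mkOfCompact_apply] at h
    rw [hφ0 rfl, hφ1 rfl] at h
    exact zero_ne_one h
  have hclosed : IsClosed {y : X | ∀ n ∈ N, n • y = y} := by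
    simp only [Set.ofPred_forall]
    exact isClosed_iInter fun n => isClosed_iInter fun _ =>
      isClosed_eq (continuous_const_smul n) continuous_id
  -- The same conjugation shows that `G` preserves the set of points fixed by `N`.
  have huniv := (eq_empty_or_univ_of_smul_invariant_closed G hclosed (by
    rintro g _ ⟨y, hy, rfl⟩ n hn
    have h := hy (g⁻¹ * n * g) (by simpa using hN.conj_mem n hn g⁻¹)
    change n • g • y = g • y
    conv_rhs => rw [← h]
    rw [smul_smul, smul_smul]
    congr 1
    group)).resolve_left (Set.nonempty_iff_ne_empty.1 ⟨c, hfix⟩)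
  exact (huniv ▸ Set.mem_univ x : x ∈ {y : X | ∀ n ∈ N, n • y = y}) r hr

/-! ### Boundaries of quotients -/

/-- Whether a space is a boundary depends only on the group of homeomorphisms that acts. -/
theorem isBoundary_iff_of_surjective {G : Type u} {H : Type v} [Group G] [Group H] {π : G → H}
    (hπ : Function.Surjective π) {X : Type w} [TopologicalSpace X] [MulAction G X] [MulAction H X]
    (h : ∀ (g : G) (x : X), π g • x = g • x) : IsBoundary H X ↔ IsBoundary G X := by
  have hc : ContinuousConstSMul H X ↔ ContinuousConstSMul G X := by
    refine ⟨fun hc => ⟨fun g => ?_⟩, fun hc => ⟨fun k => ?_⟩⟩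
    · simpa only [h] using continuous_const_smul (T := X) (π g)
    · obtain ⟨g, rfl⟩ := hπ k
      simpa only [h] using continuous_const_smul (T := X) g
  have ho : ∀ x : X, MulAction.orbit H x = MulAction.orbit G x := fun x =>
    (hπ.range_comp fun k : H => k • x).symm.trans (congrArg Set.range (funext fun g => h g x))
  have hm : MulAction.IsMinimal H X ↔ MulAction.IsMinimal G X :=
    ⟨fun hm => ⟨fun x => ho x ▸ hm.dense_orbit x⟩, fun hm => ⟨fun x => (ho x).symm ▸ hm.dense_orbit x⟩⟩
  have hs : IsStronglyProximal H X ↔ IsStronglyProximal G X := by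
    unfold IsStronglyProximal
    simp only [hπ.exists, h]
  exact ⟨fun hX => ⟨⟨hX.nonempty, hX.compactSpace, hX.t2Space, hc.1 hX.continuousConstSMul⟩,
      hm.1 hX.isMinimal, hs.1 hX.isStronglyProximal⟩,
    fun hX => ⟨⟨hX.nonempty, hX.compactSpace, hX.t2Space, hc.2 hX.continuousConstSMul⟩,
      hm.2 hX.isMinimal, hs.2 hX.isStronglyProximal⟩⟩

/-- The Furstenberg boundary of a quotient by a normal subgroup that acts trivially on the
Furstenberg boundary. -/
theorem IsFurstenbergBoundary.exists_homeomorph_quotient {G : Type u} [Group G] {N : Subgroup G}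
    [N.Normal] {X : Type v} [TopologicalSpace X] [MulAction G X] {Y : Type w} [TopologicalSpace Y]
    [MulAction (G ⧸ N) Y] (hX : IsFurstenbergBoundary G X) (hY : IsFurstenbergBoundary (G ⧸ N) Y)
    (hN : ∀ n ∈ N, ∀ x : X, n • x = x) :
    ∃ φ : X ≃ₜ Y, ∀ (g : G) (x : X), φ (g • x) = (QuotientGroup.mk g : G ⧸ N) • φ x := by
  have hπ : Function.Surjective (QuotientGroup.mk : G → G ⧸ N) := QuotientGroup.mk_surjective
  let _ : MulAction G Y := MulAction.compHom Y (QuotientGroup.mk' N)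
  -- The triviality hypothesis `hN` is exactly what lets the permutation representation of `G` on
  -- `X` descend to the quotient.
  let _ : MulAction (G ⧸ N) X := MulAction.compHom X
    (QuotientGroup.lift N (MulAction.toPermHom G X) fun n hn => Equiv.ext (hN n hn))
  have hXq : IsBoundary (G ⧸ N) X :=
    (isBoundary_iff_of_surjective hπ fun _ _ => rfl).2 hX.toIsBoundary
  have hYG : IsBoundary G Y := (isBoundary_iff_of_surjective hπ fun _ _ => rfl).1 hY.toIsBoundary
  obtain ⟨p, hp, hpe, -⟩ := hX.exists_map Y hYG
  obtain ⟨q, hq, hqe, -⟩ := hY.exists_map X hXq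
  have hqe' : ∀ (g : G) (y : Y), q (g • y) = g • q y := fun g y => hqe (QuotientGroup.mk g) y
  have := hX.compactSpace
  have := hX.continuousConstSMul
  have := hX.isMinimal
  have := hYG.compactSpace
  have := hYG.continuousConstSMul
  have := hYG.isMinimal
  exact ⟨{  toFun := p
            invFun := q
            -- Each composite is a `G`-equivariant self-map of a boundary, as is the identity, so
            -- uniqueness identifies them.
            left_inv := hX.toIsBoundary.equivariant_map_unique (hq.comp hp) continuous_id
              (fun g x => (congrArg q (hpe g x)).trans (hqe' g (p x))) fun _ _ => rfl
            right_inv := hYG.equivariant_map_unique (hp.comp hq) continuous_id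
              (fun g y => (congrArg p (hqe' g y)).trans (hpe g (q y))) fun _ _ => rfl
            continuous_toFun := hp
            continuous_invFun := hq }, hpe⟩

/-- The Furstenberg boundary is determined only up to isomorphism, so both parts range over all its
models, in arbitrary universes. -/
theorem mainTheorem12 (G : Type u) [Group G] :
    (∀ (X : Type v) [TopologicalSpace X] [MulAction G X]
        (Y : Type w) [TopologicalSpace Y] [MulAction (G ⧸ amenableRadical G) Y],
        IsFurstenbergBoundary G X →
        IsFurstenbergBoundary (G ⧸ amenableRadical G) Y →
        ∃ φ : X ≃ₜ Y, ∀ (g : G) (x : X),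
          φ (g • x) = (QuotientGroup.mk g : G ⧸ amenableRadical G) • φ x) ∧
    (∀ (X : Type v) [TopologicalSpace X] [MulAction G X],
        IsFurstenbergBoundary G X → IsTopologicallyFree G X → amenableRadical G = ⊥) := by
  have htriv : ∀ (X : Type v) [TopologicalSpace X] [MulAction G X], IsBoundary G X →
      ∀ r ∈ amenableRadical G, ∀ x : X, r • x = x := fun X _ _ hX r hr x =>
    hX.smul_eq_of_amenable inferInstance (isGreatest_amenableRadical G).1.2 hr x
  refine ⟨fun X _ _ Y _ _ hX hY => hX.exists_homeomorph_quotient hY (htriv X hX.toIsBoundary),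
    fun X _ _ hX hfree => (Subgroup.eq_bot_iff_forall _).2 fun s hs => ?_⟩
  by_contra hne
  have := hX.nonempty
  obtain ⟨x, hx⟩ := (hfree s hne).nonempty
  exact hx (htriv X hX.toIsBoundary s hs x)
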